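/- Let $\mathcal H$ be a real Hilbert space, let $A,B,C:\mathcal H\rightrightarrows\mathcal H$ be (possibly multi-valued, possibly partially defined) operators with $A$ and $B$ monotone and $C$ $\beta_C$-cocoercive, i.e. $\langle x-y,u-v\rangle\ge\beta_C\|u-v\|^2$ for all $u\in Cx$, $v\in Cy$. Let $0<\alpha<4\beta_C<\infty$ and $\lambda\in\left(0,\,2-\frac{\alpha}{2\beta_C}\right)$. Write $J_{\alpha A}=(I+\alpha A)^{-1}$ and $J_{\alpha B}=(I+\alpha B)^{-1}$ for the resolvents, and let $$T=(1-\lambda)I+\lambda\bigl(I-J_{\alpha B}+J_{\alpha A}(2J_{\alpha B}-I-\alpha CJ_{\alpha B})\bigr)$$ be the Davis--Yin splitting (DYS) operator. Call $T$ $\rho$-contractive if $0\le\rho<1$ and $\|u-v\|\le\rho\|x-y\|$ whenever $u\in Tx$ and $v\in Ty$. For $L,\mu\in(0,\infty)$ put $$\rho(L,\mu)=\sqrt{1-\min\left\{\frac{2\alpha\mu\lambda(2-\lambda)}{(1+\alpha^2L^2)(2-\lambda+2\alpha\mu)},\ \frac{2\alpha\lambda\bigl((2-\lambda)(\mu+L)+2\alpha\mu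 L\bigr)}{(1+\alpha L)^2(2-\lambda+2\alpha\mu)}\right\}}.$$ 1. If $A$ is $L_A$-Lipschitz ($\|u-v\|\le L_A\|x-y\|$ for all $u\in Ax$, $v\in Ay$) and $B$ is $\mu_B$-strongly monotone ($\langle x-y,u-v\rangle\ge\mu_B\|x-y\|^2$ for all $u\in Bx$, $v\in By$) with $L_A,\mu_B\in(0,\infty)$, then $T$ is $\rho(L_A,\mu_B)$-contractive. 2. Symmetrically, if $A$ is $\mu_A$-strongly monotone and $B$ is $L_B$-Lipschitz with $\mu_A,L_B\in(0,\infty)$, then $T$ is $\rho(L_B,\mu_A)$-contractive. -/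

import Mathlib

/-- A multi-valued operator `A : H ⇉ H`: each point `x` is sent to the set `A x`. -/
abbrev MultiOp (H : Type*) := H → Set H

namespace MultiOp

variable {H : Type*} [NormedAddCommGroup H] [InnerProductSpace ℝ H]

/-- The identity operator. -/
def ident : MultiOp H := fun x => {x}

/-- The sum `A + B`. -/
def add (A B : MultiOp H) : MultiOp H := fun x => {w | ∃ u ∈ A x, ∃ v ∈ B x, w = u + v}

/-- The scalar multiple `c A`. -/
def smul (c : ℝ) (A : MultiOp H) : MultiOp H := fun x => {w | ∃ u ∈ A x, w = c • u}

/-- The difference `A - B = A + (-1) B`. -/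
def sub (A B : MultiOp H) : MultiOp H := add A (smul (-1) B)

/-- The composition `A B` (first `B`, then `A`). -/
def comp (A B : MultiOp H) : MultiOp H := fun x => {s | ∃ u ∈ B x, s ∈ A u}

/-- The inverse operator: `x ∈ A⁻¹ u` iff `u ∈ A x`. -/
def inverse (A : MultiOp H) : MultiOp H := fun u => {x | u ∈ A x}

/-- The resolvent `J_{αA} = (I + αA)⁻¹`. -/
def resolvent (α : ℝ) (A : MultiOp H) : MultiOp H := inverse (add ident (smul α A))

/-- `A` is monotone. -/
def IsMonotone (A : MultiOp H) : Prop :=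
  ∀ x y : H, ∀ u ∈ A x, ∀ v ∈ A y, 0 ≤ inner ℝ (x - y) (u - v)

/-- `A` is `μ`-strongly monotone. -/
def IsStronglyMonotone (μ : ℝ) (A : MultiOp H) : Prop :=
  ∀ x y : H, ∀ u ∈ A x, ∀ v ∈ A y, μ * ‖x - y‖ ^ 2 ≤ inner ℝ (x - y) (u - v)

/-- `A` is `L`-Lipschitz on its domain `{x | A x ≠ ∅}`. Taking `x = y` shows that
`A` is then single-valued. -/
def IsLipschitz (L : ℝ) (A : MultiOp H) : Prop :=
  ∀ x y : H, ∀ u ∈ A x, ∀ v ∈ A y, ‖u - v‖ ≤ L * ‖x - y‖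

/-- `A` is `β`-cocoercive on its domain `{x | A x ≠ ∅}`. For `β > 0`, taking `x = y` shows that
`A` is then single-valued. -/
def IsCocoercive (β : ℝ) (A : MultiOp H) : Prop :=
  ∀ x y : H, ∀ u ∈ A x, ∀ v ∈ A y, β * ‖u - v‖ ^ 2 ≤ inner ℝ (x - y) (u - v)

/-- `T` is `ρ`-contractive: it is `ρ`-Lipschitz on its domain, with a factor `ρ ∈ [0, 1)`. -/
def IsContractive (ρ : ℝ) (T : MultiOp H) : Prop :=
  0 ≤ ρ ∧ ρ < 1 ∧ IsLipschitz ρ T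

/-- The Davis--Yin splitting operator
`(1 - lam) I + lam (I - J_{αB} + J_{αA} (2 J_{αB} - I - α C J_{αB}))`
with stepsize `α` and averaging parameter `lam`. -/
def dys (A B C : MultiOp H) (α lam : ℝ) : MultiOp H :=
  add (smul (1 - lam) ident)
    (smul lam
      (add (sub ident (resolvent α B))
        (comp (resolvent α A)
          (sub (sub (smul 2 (resolvent α B)) ident)
            (comp (smul α C) (resolvent α B))))))

end MultiOp

/-!
The proof turns a pair of evaluations of the Davis--Yin operator into an energy identity and then
bounds the energy from below by sums of squares.

Let `x ↦ u`, `y ↦ v` be two evaluations of `T` and write `z = x - y`. Denote by `p`, `q` the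
differences of the outputs of `J_{αB}`, `J_{αA}`, by `b`, `a`, `c` the differences of the values of
`αB`, `αA`, `αC` there, and put `θ = 2 - lam`. Then `z = p + b`, `q + a = p - b - c`,
`u - v = z + lam (q - p)`, and expanding the square gives
`‖z‖² - ‖u - v‖² = 2 lam G` with `G = θ/2 ‖q - p‖² + ⟪q, c⟫ + ⟪q, a⟫ + ⟪p, b⟫`.
The cocoercivity of `C` enters only through its consequence `‖c‖² ≤ 2 θ ⟪p, c⟫`, which is what the
restriction on `lam` provides; with `c = θ e` it reads `‖e‖² ≤ 2 ⟪p, e⟫`.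

It remains to show `m ‖z‖² ≤ G`, where `2 lam m` is the minimum in the statement. With
`K = μ θ / (θ + 2 μ)` and `α` absorbed into `μ` and `L`, this `m` is the smaller of
`K / (1 + L²)` and `(K + L) / (1 + L)²`. These are the two extreme cases of the inequality
`m ‖q + a‖² ≤ K ‖q‖² + ⟪q, a⟫` for a monotone `L`-Lipschitz pair `(q, a)`: it is affine in
`⟪q, a⟫ ∈ [0, L ‖q‖²]` (`mul_norm_add_sq_le_of_lipschitz`).

* If `A` is strongly monotone and `B` Lipschitz, completing a square in `q` leaves
  `K ‖p‖² + ⟪p, b⟫ ≤ G`, and the inequality applies to `(p, b)`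
  (`gap_of_lipschitz_of_stronglyMonotone`).
* If `A` is Lipschitz and `B` strongly monotone, `z` is no longer the sum of the input and output of
  the Lipschitz operator. One uses instead the multipliers dual to those of the first case:
  `G - m ‖z‖²` is a combination, with nonnegative coefficients, of the strong monotonicity
  of `B`, the inequality for `C`, one square, and
  `K ‖q‖² + ⟪q, a⟫ - m ‖q + a‖²` (`gap_of_stronglyMonotone_of_lipschitz`).
-/

namespace MultiOp

variable {H : Type*} [NormedAddCommGroup H] [InnerProductSpace ℝ H]

/-! ### Evaluations of the splitting operator -/

/-- The two occurrences of `J_{αB}` in the splitting operator give the same point, since the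
resolvent of a monotone operator is single-valued. -/
lemma exists_of_mem_dys {A B C : MultiOp H} {α lam : ℝ} (hα : 0 < α) (hB : B.IsMonotone)
    {z u : H} (hu : u ∈ dys A B C α lam z) :
    ∃ p q : H, ∃ b ∈ B p, ∃ c ∈ C p, ∃ a ∈ A q,
      z = p + α • b ∧ α • a = p - α • b - α • c - q ∧ u = z + lam • (q - p) := by
  simp only [dys, add, sub, smul, comp, resolvent, inverse, ident, Set.mem_ofPred_eq,
    Set.mem_singleton_iff, exists_eq_left] at hu
  obtain ⟨_, ⟨_, ⟨_, ⟨_, ⟨p, ⟨_, ⟨b, hb, rfl⟩, hz⟩, rfl⟩, rfl⟩, q,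
    ⟨_, ⟨_, ⟨_, ⟨p₁, ⟨_, ⟨b₁, hb₁, rfl⟩, hz₁⟩, rfl⟩, rfl⟩, _,
      ⟨_, ⟨p₂, ⟨_, ⟨b₂, hb₂, rfl⟩, hz₂⟩, c, hc, rfl⟩, rfl⟩, rfl⟩, _, ⟨a, ha, rfl⟩, hq⟩, rfl⟩,
    rfl⟩, rfl⟩ := hu
  have unique : ∀ p' b', b' ∈ B p' → z = p' + α • b' → p' = p := by
    intro p' b' hb' hz'
    have h := mul_nonneg hα.le (hB p' p b' hb' b hb)
    have e : α • (b' - b) = -(p' - p) := by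
      rw [smul_sub, sub_eq_iff_eq_add, ← sub_eq_iff_eq_add'.mpr hz', ← sub_eq_iff_eq_add'.mpr hz]
      abel
    rw [← real_inner_smul_right, e, inner_neg_right, real_inner_self_eq_norm_sq] at h
    exact sub_eq_zero.mp (norm_eq_zero.mp (pow_eq_zero_iff two_ne_zero |>.mp
      (le_antisymm (by linarith) (sq_nonneg _))))
  rw [unique p₁ b₁ hb₁ hz₁, unique p₂ b₂ hb₂ hz₂] at *
  refine ⟨p, q, b, hb, c, hc, a, ha, hz, ?_, ?_⟩
  · rw [← sub_eq_iff_eq_add'.mpr hq, hz]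
    module
  · module

/-! ### Quadratic inequalities for differences of evaluations -/

/-- The right-hand side minus the left-hand side is affine in `⟪q, a⟫ ∈ [0, L ‖q‖²]` once `‖a‖` is
replaced by `L ‖q‖`; the two bounds on `m` are the two endpoints. -/
lemma mul_norm_add_sq_le_of_lipschitz {K L m : ℝ} (hL : 0 < L) (hm : 0 ≤ m)
    (h₁ : m * (1 + L ^ 2) ≤ K) (h₂ : m * (1 + L) ^ 2 ≤ K + L) {q a : H}
    (hmono : 0 ≤ inner ℝ q a) (hlip : ‖a‖ ≤ L * ‖q‖) :
    m * ‖q + a‖ ^ 2 ≤ K * ‖q‖ ^ 2 + inner ℝ q a := by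
  have hs : inner ℝ q a ≤ L * ‖q‖ ^ 2 := by
    nlinarith [real_inner_le_norm q a, mul_le_mul_of_nonneg_left hlip (norm_nonneg q)]
  have ha : m * ‖a‖ ^ 2 ≤ m * (L ^ 2 * ‖q‖ ^ 2) := by
    rw [← mul_pow]
    gcongr
  rw [norm_add_sq_real]
  refine le_of_mul_le_mul_left ?_ hL
  nlinarith [mul_le_mul_of_nonneg_left ha hL.le,
    mul_nonneg (sub_nonneg.2 h₁) (sub_nonneg.2 hs), mul_nonneg (sub_nonneg.2 h₂) hmono]

/-- Completing the square in `q`. -/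
lemma gap_of_lipschitz_of_stronglyMonotone {θ μ L m : ℝ} (hθ : 0 < θ) (hμ : 0 < μ) (hL : 0 < L)
    (hm : 0 ≤ m) (h₁ : m * (1 + L ^ 2) ≤ μ * θ / (θ + 2 * μ))
    (h₂ : m * (1 + L) ^ 2 ≤ μ * θ / (θ + 2 * μ) + L) {p q a b e : H}
    (hA : μ * ‖q‖ ^ 2 ≤ inner ℝ q a) (hB : 0 ≤ inner ℝ p b) (hlip : ‖b‖ ≤ L * ‖p‖)
    (hC : ‖e‖ ^ 2 ≤ 2 * inner ℝ p e) :
    m * ‖p + b‖ ^ 2 ≤ θ / 2 * ‖q - p‖ ^ 2 + θ * inner ℝ q e + inner ℝ q a + inner ℝ p b := by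
  have hs : 0 < θ + 2 * μ := by positivity
  have key : μ * θ / (θ + 2 * μ) * ‖p‖ ^ 2 ≤
      θ / 2 * ‖q - p‖ ^ 2 + θ * inner ℝ q e + μ * ‖q‖ ^ 2 := by
    have hv := sq_nonneg ‖(θ + 2 * μ) • q - θ • p + θ • e‖
    have hc := mul_nonneg (sq_nonneg θ) (sub_nonneg.2 hC)
    rw [div_mul_eq_mul_div, div_le_iff₀ hs]
    simp only [← real_inner_self_eq_norm_sq, inner_add_left, inner_add_right, inner_sub_left,
      inner_sub_right, real_inner_smul_left, real_inner_smul_right] at *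
    rw [real_inner_comm p q, real_inner_comm e q, real_inner_comm e p] at *
    nlinarith
  have := mul_norm_add_sq_le_of_lipschitz hL hm h₁ h₂ hB hlip
  linarith

/-- The multipliers are the duals of those that prove `gap_of_lipschitz_of_stronglyMonotone`: the
contraction estimate for a linear operator passes to its adjoint, and the adjoint of the splitting
operator is a splitting operator with `A` and `B` interchanged. -/
lemma gap_of_stronglyMonotone_of_lipschitz {θ μ L m : ℝ} (hθ : 0 < θ) (hμ : 0 < μ) (hL : 0 < L)
    (hm : 0 < m) (h₁ : m * (1 + L ^ 2) ≤ μ * θ / (θ + 2 * μ))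
    (h₂ : m * (1 + L) ^ 2 ≤ μ * θ / (θ + 2 * μ) + L) {p q a b e : H}
    (ha : a = p - b - θ • e - q)
    (hA : 0 ≤ inner ℝ q a) (hlip : ‖a‖ ≤ L * ‖q‖) (hB : μ * ‖p‖ ^ 2 ≤ inner ℝ p b)
    (hC : ‖e‖ ^ 2 ≤ 2 * inner ℝ p e) :
    m * ‖p + b‖ ^ 2 ≤ θ / 2 * ‖q - p‖ ^ 2 + θ * inner ℝ q e + inner ℝ q a + inner ℝ p b := by
  have hs : 0 < θ + 2 * μ := by positivity
  have hlip' := mul_norm_add_sq_le_of_lipschitz hL hm.le h₁ h₂ hA hlip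
  set K := μ * θ / (θ + 2 * μ) with hK
  have hKs : K * (θ + 2 * μ) = μ * θ := div_mul_cancel₀ _ hs.ne'
  have hmK : m ≤ K := by nlinarith [mul_pos hm (pow_pos hL 2)]
  have hKθ : 2 * K ≤ θ := by nlinarith
  -- `R` is the squared contraction factor `1 - 2 lam m`.
  set R := 1 - 2 * (2 - θ) * m with hR
  have hR0 : 0 ≤ R := by
    rcases le_total θ 2 with h | h
    · nlinarith [sq_nonneg (θ - 1), mul_nonneg (sub_nonneg.2 h) (sub_nonneg.2 (hmK))]
    · nlinarith [mul_nonneg (sub_nonneg.2 h) hm.le]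
  set W := (θ + 2 * μ) * (1 - 4 * m) + 4 * m * (μ * θ) with hW
  have hW0 : 0 < W := by
    have : W = (θ + 2 * μ) * (1 - 4 * m + 4 * m * K) := by rw [hW, ← hKs]; ring
    rw [this]
    refine mul_pos hs ?_
    nlinarith [mul_le_mul_of_nonneg_left h₁ hm.le, sq_nonneg (1 - 2 * m), pow_pos (mul_pos hm hL) 2]
  have hv := sq_nonneg ‖W • (e - p) + (θ * (1 - 2 * m)) • q - (2 * m * θ) • a‖
  have hB' := mul_nonneg (mul_nonneg hW0.le hR0) (sub_nonneg.2 hB)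
  have hC' := mul_nonneg (mul_nonneg (mul_nonneg hW0.le hR0) hs.le) (sub_nonneg.2 hC)
  have hL' := mul_nonneg (mul_nonneg hR0 hs.le) (sub_nonneg.2 hlip')
  have identity : 2 * W * (θ / 2 * ‖q - p‖ ^ 2 + θ * inner ℝ q e + inner ℝ q a + inner ℝ p b
        - m * ‖p + b‖ ^ 2) =
      2 * (W * R * (inner ℝ p b - μ * ‖p‖ ^ 2)) +
      W * R * (θ + 2 * μ) * (2 * inner ℝ p e - ‖e‖ ^ 2) +
      ‖W • (e - p) + (θ * (1 - 2 * m)) • q - (2 * m * θ) • a‖ ^ 2 +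
      2 * (R * (θ + 2 * μ) * (K * ‖q‖ ^ 2 + inner ℝ q a - m * ‖q + a‖ ^ 2)) := by
    have hb : b = p - a - θ • e - q := by rw [ha]; abel
    have hKq : R * (θ + 2 * μ) * (K * ‖q‖ ^ 2 + inner ℝ q a - m * ‖q + a‖ ^ 2) =
        R * (μ * θ * ‖q‖ ^ 2 + (θ + 2 * μ) * (inner ℝ q a - m * ‖q + a‖ ^ 2)) := by
      rw [← hKs]; ring
    rw [hKq, hb]
    clear_value K
    simp only [← real_inner_self_eq_norm_sq, inner_add_left, inner_add_right, inner_sub_left,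
      inner_sub_right, real_inner_smul_left, real_inner_smul_right]
    rw [real_inner_comm p q, real_inner_comm e q, real_inner_comm e p, real_inner_comm a q,
      real_inner_comm a p, real_inner_comm a e, hR, hW]
    ring
  have : 0 ≤ 2 * W * (θ / 2 * ‖q - p‖ ^ 2 + θ * inner ℝ q e + inner ℝ q a + inner ℝ p b
        - m * ‖p + b‖ ^ 2) := by
    rw [identity]
    positivity
  exact sub_nonneg.1 (nonneg_of_mul_nonneg_right this (by positivity))

/-! ### Contraction -/

/-- Reduction of contractivity to a lower bound for the energy `G`. The vector `e` stands for
`α (c₁ - c₂) / θ`, and `a` is already multiplied by `α`. -/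
lemma isContractive_dys_of_gap {A B C : MultiOp H} {α β lam M : ℝ} (hα : 0 < α)
    (hαβ : α < 4 * β) (hlam : lam ∈ Set.Ioo 0 (2 - α / (2 * β))) (hB : B.IsMonotone)
    (hC : C.IsCocoercive β) (hM : 0 < M)
    (hgap : ∀ p₁ p₂ q₁ q₂ : H, ∀ b₁ ∈ B p₁, ∀ b₂ ∈ B p₂, ∀ a₁ ∈ A q₁, ∀ a₂ ∈ A q₂, ∀ e : H,
      ‖e‖ ^ 2 ≤ 2 * inner ℝ (p₁ - p₂) e →
      α • (a₁ - a₂) = (p₁ - p₂) - α • (b₁ - b₂) - (2 - lam) • e - (q₁ - q₂) →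
      M / (2 * lam) * ‖(p₁ - p₂) + α • (b₁ - b₂)‖ ^ 2 ≤
        (2 - lam) / 2 * ‖(q₁ - q₂) - (p₁ - p₂)‖ ^ 2 + (2 - lam) * inner ℝ (q₁ - q₂) e +
          inner ℝ (q₁ - q₂) (α • (a₁ - a₂)) + inner ℝ (p₁ - p₂) (α • (b₁ - b₂))) :
    (dys A B C α lam).IsContractive √(1 - M) := by
  refine ⟨Real.sqrt_nonneg _, (Real.sqrt_lt' one_pos).2 (by linarith), ?_⟩
  intro x y u hu v hv
  obtain ⟨p₁, q₁, b₁, hb₁, c₁, hc₁, a₁, ha₁, hx, hax, hux⟩ := exists_of_mem_dys hα hB hu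
  obtain ⟨p₂, q₂, b₂, hb₂, c₂, hc₂, a₂, ha₂, hy, hay, hvy⟩ := exists_of_mem_dys hα hB hv
  have hlam0 : 0 < lam := hlam.1
  have hβ : 0 < β := by linarith
  have hθα : α < (2 - lam) * (2 * β) := (div_lt_iff₀ (by positivity)).1 (by linarith [hlam.2])
  have hθ : 0 < 2 - lam := pos_of_mul_pos_left (hα.trans hθα) (by positivity)
  obtain ⟨e, he⟩ : ∃ e : H, α • (c₁ - c₂) = (2 - lam) • e :=
    ⟨(2 - lam)⁻¹ • α • (c₁ - c₂), by rw [smul_inv_smul₀ hθ.ne']⟩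
  have hec : ‖e‖ ^ 2 ≤ 2 * inner ℝ (p₁ - p₂) e := by
    have hc : c₁ - c₂ = ((2 - lam) / α) • e := by
      rw [div_eq_inv_mul, mul_smul, ← he, inv_smul_smul₀ hα.ne']
    have h := hC p₁ p₂ c₁ hc₁ c₂ hc₂
    rw [hc, real_inner_smul_right, norm_smul, mul_pow, Real.norm_eq_abs, sq_abs] at h
    have h' : ((2 - lam) * β / α) * ‖e‖ ^ 2 ≤ inner ℝ (p₁ - p₂) e := by
      refine le_of_mul_le_mul_left ?_ (div_pos hθ hα)
      calc _ = _ := by ring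
        _ ≤ _ := h
    have : 1 / 2 ≤ (2 - lam) * β / α := by rw [le_div_iff₀ hα]; linarith
    nlinarith [mul_le_mul_of_nonneg_right this (sq_nonneg ‖e‖)]
  have hrel : α • (a₁ - a₂) = (p₁ - p₂) - α • (b₁ - b₂) - (2 - lam) • e - (q₁ - q₂) := by
    rw [← he, smul_sub, hax, hay]
    module
  have hG := hgap p₁ p₂ q₁ q₂ b₁ hb₁ b₂ hb₂ a₁ ha₁ a₂ ha₂ e hec hrel
  have hxy : x - y = (p₁ - p₂) + α • (b₁ - b₂) := by rw [hx, hy]; module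
  have huv : u - v = (p₁ - p₂) + α • (b₁ - b₂) + lam • ((q₁ - q₂) - (p₁ - p₂)) := by
    rw [hux, hvy, ← hxy]; module
  rw [hxy, huv]
  generalize p₁ - p₂ = p at *
  generalize q₁ - q₂ = q at *
  generalize α • (b₁ - b₂) = b at *
  generalize α • (a₁ - a₂) = a at *
  have energy : ‖p + b + lam • (q - p)‖ ^ 2 = ‖p + b‖ ^ 2 - 2 * lam *
      ((2 - lam) / 2 * ‖q - p‖ ^ 2 + (2 - lam) * inner ℝ q e + inner ℝ q a + inner ℝ p b) := by
    rw [hrel]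
    simp only [← real_inner_self_eq_norm_sq, inner_add_left, inner_add_right, inner_sub_left,
      inner_sub_right, real_inner_smul_left, real_inner_smul_right]
    rw [real_inner_comm p q, real_inner_comm b q, real_inner_comm b p]
    ring
  have hsq : ‖p + b + lam • (q - p)‖ ^ 2 ≤ (1 - M) * ‖p + b‖ ^ 2 := by
    rw [energy]
    have h := mul_le_mul_of_nonneg_left hG (by positivity : 0 ≤ 2 * lam)
    have h2 : 2 * lam * (M / (2 * lam) * ‖p + b‖ ^ 2) = M * ‖p + b‖ ^ 2 := by
      field_simp
    linarith
  calc _ ≤ √((1 - M) * ‖p + b‖ ^ 2) := Real.le_sqrt_of_sq_le hsq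
    _ = √(1 - M) * ‖p + b‖ := by
      rw [Real.sqrt_mul' _ (sq_nonneg _), Real.sqrt_sq (norm_nonneg _)]

/-- The minimum in the contraction factor, divided by `2 lam`, satisfies the two bounds that the
energy estimates need. -/
lemma contraction_gap_bounds {α lam L μ : ℝ} (hα : 0 < α) (hlam : 0 < lam) (hθ : 0 < 2 - lam)
    (hL : 0 < L) (hμ : 0 < μ) {M : ℝ}
    (hM : M = min (2 * α * μ * lam * (2 - lam) / ((1 + α ^ 2 * L ^ 2) * (2 - lam + 2 * α * μ)))
      (2 * α * lam * ((2 - lam) * (μ + L) + 2 * α * μ * L) /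
        ((1 + α * L) ^ 2 * (2 - lam + 2 * α * μ)))) :
    0 < M ∧
    M / (2 * lam) * (1 + (α * L) ^ 2) ≤ α * μ * (2 - lam) / (2 - lam + 2 * (α * μ)) ∧
    M / (2 * lam) * (1 + α * L) ^ 2 ≤ α * μ * (2 - lam) / (2 - lam + 2 * (α * μ)) + α * L := by
  have hs : 0 < 2 - lam + 2 * α * μ := by positivity
  have hs' : 0 < 2 - lam + 2 * (α * μ) := by positivity
  refine ⟨?_, ?_, ?_⟩
  · rw [hM]
    exact lt_min (by positivity) (by positivity)
  · calc _ ≤ 2 * α * μ * lam * (2 - lam) / ((1 + α ^ 2 * L ^ 2) * (2 - lam + 2 * α * μ)) /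
          (2 * lam) * (1 + (α * L) ^ 2) := by
          gcongr
          exact hM.trans_le (min_le_left _ _)
      _ = _ := by
          rw [mul_pow, ← mul_assoc 2 α μ]
          field_simp
  · calc _ ≤ 2 * α * lam * ((2 - lam) * (μ + L) + 2 * α * μ * L) /
          ((1 + α * L) ^ 2 * (2 - lam + 2 * α * μ)) / (2 * lam) * (1 + α * L) ^ 2 := by
          gcongr
          exact hM.trans_le (min_le_right _ _)
      _ = _ := by
          rw [← mul_assoc 2 α μ]
          field_simp
          ring

lemma IsLipschitz.norm_smul_sub_le {A : MultiOp H} {α L : ℝ} (hα : 0 < α) (hA : A.IsLipschitz L)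
    {x y u v : H} (hu : u ∈ A x) (hv : v ∈ A y) : ‖α • (u - v)‖ ≤ α * L * ‖x - y‖ := by
  rw [norm_smul, Real.norm_of_nonneg hα.le, mul_assoc]
  exact mul_le_mul_of_nonneg_left (hA x y u hu v hv) hα.le

lemma IsStronglyMonotone.le_inner_smul_sub {A : MultiOp H} {α μ : ℝ} (hα : 0 < α)
    (hA : A.IsStronglyMonotone μ) {x y u v : H} (hu : u ∈ A x) (hv : v ∈ A y) :
    α * μ * ‖x - y‖ ^ 2 ≤ inner ℝ (x - y) (α • (u - v)) := by
  rw [real_inner_smul_right, mul_assoc]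
  exact mul_le_mul_of_nonneg_left (hA x y u hu v hv) hα.le

lemma IsMonotone.inner_smul_sub_nonneg {A : MultiOp H} {α : ℝ} (hα : 0 < α)
    (hA : A.IsMonotone) {x y u v : H} (hu : u ∈ A x) (hv : v ∈ A y) :
    0 ≤ inner ℝ (x - y) (α • (u - v)) := by
  rw [real_inner_smul_right]
  exact mul_nonneg hα.le (hA x y u hu v hv)

end MultiOp

theorem theorem4 {H : Type*} [NormedAddCommGroup H] [InnerProductSpace ℝ H] [CompleteSpace H]
    (A B C : MultiOp H) (α β lam : ℝ)
    (hα : 0 < α) (hαβ : α < 4 * β) (hlam : lam ∈ Set.Ioo 0 (2 - α / (2 * β)))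
    (hA : A.IsMonotone) (hB : B.IsMonotone) (hC : C.IsCocoercive β) :
    (∀ L μ : ℝ, 0 < L → 0 < μ → A.IsLipschitz L → B.IsStronglyMonotone μ →
      (MultiOp.dys A B C α lam).IsContractive
        (√(1 - min
          (2 * α * μ * lam * (2 - lam) / ((1 + α ^ 2 * L ^ 2) * (2 - lam + 2 * α * μ)))
          (2 * α * lam * ((2 - lam) * (μ + L) + 2 * α * μ * L) /
            ((1 + α * L) ^ 2 * (2 - lam + 2 * α * μ)))))) ∧
    (∀ L μ : ℝ, 0 < L → 0 < μ → B.IsLipschitz L → A.IsStronglyMonotone μ →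
      (MultiOp.dys A B C α lam).IsContractive
        (√(1 - min
          (2 * α * μ * lam * (2 - lam) / ((1 + α ^ 2 * L ^ 2) * (2 - lam + 2 * α * μ)))
          (2 * α * lam * ((2 - lam) * (μ + L) + 2 * α * μ * L) /
            ((1 + α * L) ^ 2 * (2 - lam + 2 * α * μ)))))) := by
  have hβ : 0 < β := by linarith
  have hθ : 0 < 2 - lam := by
    have : 0 < α / (2 * β) := by positivity
    linarith [hlam.2]
  constructor
  · intro L μ hL hμ hAL hBμ
    obtain ⟨hM, h₁, h₂⟩ := MultiOp.contraction_gap_bounds hα hlam.1 hθ hL hμ rfl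
    refine MultiOp.isContractive_dys_of_gap hα hαβ hlam hB hC hM ?_
    intro p₁ p₂ q₁ q₂ b₁ hb₁ b₂ hb₂ a₁ ha₁ a₂ ha₂ e he hrel
    exact MultiOp.gap_of_stronglyMonotone_of_lipschitz hθ (mul_pos hα hμ) (mul_pos hα hL)
      (div_pos hM (mul_pos two_pos hlam.1)) h₁ h₂ hrel (hA.inner_smul_sub_nonneg hα ha₁ ha₂)
      (hAL.norm_smul_sub_le hα ha₁ ha₂) (hBμ.le_inner_smul_sub hα hb₁ hb₂) he
  · intro L μ hL hμ hBL hAμ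
    obtain ⟨hM, h₁, h₂⟩ := MultiOp.contraction_gap_bounds hα hlam.1 hθ hL hμ rfl
    refine MultiOp.isContractive_dys_of_gap hα hαβ hlam hB hC hM ?_
    intro p₁ p₂ q₁ q₂ b₁ hb₁ b₂ hb₂ a₁ ha₁ a₂ ha₂ e he _
    exact MultiOp.gap_of_lipschitz_of_stronglyMonotone hθ (mul_pos hα hμ) (mul_pos hα hL)
      (div_pos hM (mul_pos two_pos hlam.1)).le h₁ h₂ (hAμ.le_inner_smul_sub hα ha₁ ha₂)
      (hB.inner_smul_sub_nonneg hα hb₁ hb₂) (hBL.norm_smul_sub_le hα hb₁ hb₂) he
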